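/- **Theorem (Poincaré–Dulac normal form).** Let $\mathbb K$ be $\mathbb R$ or $\mathbb C$ and let $f=(f^{(1)},\dots,f^{(n)})\in\mathbb K[[x_1,\dots,x_n]]^n$ be a formal vector field with $f(0)=0$, written as $$f(x)=Ax+\sum_{j\ge 2}f_j(x),\qquad A=Df(0)\in\mathbb K^{n\times n},$$ with each $f_j$ a homogeneous polynomial vector field of degree $j$. Let $A=A_s+A_n$ be the Jordan–Chevalley decomposition of $A$ ($A_s$ semisimple, $A_n$ nilpotent, $A_sA_n=A_nA_s$), and for formal vector fields $g,h$ let $[g,h]=Dh\cdot g-Dg\cdot h$, where a matrix $B$ is identified with the linear vector field $x\mapsto Bx$. Then there exist $\Phi,f^*\in\mathbb K[[x_1,\dots,x_n]]^n$ of the form $$\Phi(x)=x+\text{(terms of degree}\ge 2),\qquad f^*(x)=Ax+\sum_{j\ge 2}f_j^*(x),$$ with each $f_j^*$ homogeneous of degree $j$, such that 1. $\Phi$ is formally solution-preserving from $\dot x=f^*(x)$ to $\dot x=f(x)$, i.e. $D\Phi(x)\,f^*(x)=f(\Phi(x))$ as formal power series; 2. $f^*$ is in Poincaré–Dulac normal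 form, i.e. $[A_s,f^*]=0$. Moreover, for every formal vector field $g=A+\sum_{j\ge2}g_j$ ($g_j$ homogeneous of degree $j$), one has $[A_s,g]=0$ if and only if $[A_s,g_j]=0$ for all $j\ge 2$; in particular $[A_s,f_j^*]=0$ for all $j\ge2$. -/

import Mathlib

noncomputable section

namespace PoincareDulac

/-- `B = S + N` is the Jordan–Chevalley decomposition of `B`: `S` is semisimple, `N` is nilpotent
and `S`, `N` commute. -/
structure IsJordanChevalley {𝕜 : Type*} [Field 𝕜] {n : ℕ} (B S N : Matrix (Fin n) (Fin n) 𝕜) :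
    Prop where
  add_eq : B = S + N
  semisimple : Module.End.IsSemisimple (Matrix.toLin' S)
  nilpotent : IsNilpotent N
  commute : Commute S N

theorem exists_isJordanChevalley {𝕜 : Type*} [Field 𝕜] [PerfectField 𝕜] {n : ℕ}
    (B : Matrix (Fin n) (Fin n) 𝕜) : ∃ S, ∃ N, IsJordanChevalley B S N := by
  let e : Matrix (Fin n) (Fin n) 𝕜 ≃ₐ[𝕜] Module.End 𝕜 (Fin n → 𝕜) := Matrix.toLinAlgEquiv'
  obtain ⟨N, hN, S, hS, hnil, hss, h⟩ :=
    Module.End.exists_isNilpotent_isSemisimple (K := 𝕜) (f := e B)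
  have hc : Commute S N := Algebra.commute_of_mem_adjoin_singleton_of_commute hN
    (Algebra.commute_of_mem_adjoin_self hS).symm
  refine ⟨e.symm S, e.symm N, ?_, ?_, hnil.map e.symm, hc.map e.symm⟩
  · rw [← map_add, add_comm, ← h, AlgEquiv.symm_apply_apply]
  · have hS' : Matrix.toLin' (e.symm S) = S := e.apply_symm_apply S
    rwa [hS']

theorem IsJordanChevalley.unique {𝕜 : Type*} [Field 𝕜] [PerfectField 𝕜] {n : ℕ}
    {B S N S' N' : Matrix (Fin n) (Fin n) 𝕜} (h : IsJordanChevalley B S N)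
    (h' : IsJordanChevalley B S' N') : S = S' := by
  have := Module.End.isNilpotent_isSemisimple_unique
    (h.nilpotent.map (Matrix.toLinAlgEquiv' (R := 𝕜) (n := Fin n))) h.semisimple
    (h'.nilpotent.map (Matrix.toLinAlgEquiv' (R := 𝕜) (n := Fin n))) h'.semisimple
    (h.commute.symm.map (Matrix.toLinAlgEquiv' (R := 𝕜) (n := Fin n)))
    (h'.commute.symm.map (Matrix.toLinAlgEquiv' (R := 𝕜) (n := Fin n)))
    (by
      have e := h.add_eq.symm.trans h'.add_eq
      rw [add_comm S, add_comm S'] at e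
      have e' := congrArg (Matrix.toLinAlgEquiv' (R := 𝕜) (n := Fin n)) e
      rw [map_add, map_add] at e'
      exact e')
  exact (Matrix.toLin' (R := 𝕜)).injective this.2

/-- The semisimple part `B_s` in the (unique) Jordan–Chevalley decomposition `B = B_s + B_n`. -/
def semisimplePart {𝕜 : Type*} [Field 𝕜] [PerfectField 𝕜] {n : ℕ}
    (B : Matrix (Fin n) (Fin n) 𝕜) : Matrix (Fin n) (Fin n) 𝕜 :=
  Classical.choose (exists_isJordanChevalley B)

/-- Formal vector fields on `𝕜ⁿ`, and formal maps from `𝕜ⁿ` to itself: `n`-tuples of formal power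
series in `n` variables. -/
abbrev FormalField (𝕜 : Type*) (n : ℕ) : Type _ := Fin n → MvPowerSeries (Fin n) 𝕜

/-- The formal Jacobian matrix `Dg`. -/
def jacobian {𝕜 : Type*} [Field 𝕜] {n : ℕ} (g : FormalField 𝕜 n) :
    Matrix (Fin n) (Fin n) (MvPowerSeries (Fin n) 𝕜) :=
  Matrix.of fun i j => MvPowerSeries.pderiv 𝕜 j (g i)

/-- `g(x) = Bx + ⋯`, that is, `g(0) = 0` and `Dg(0) = B`. -/
structure HasLinearPart {𝕜 : Type*} [Field 𝕜] {n : ℕ} (g : FormalField 𝕜 n)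
    (B : Matrix (Fin n) (Fin n) 𝕜) : Prop where
  map_zero : ∀ i, MvPowerSeries.constantCoeff (g i) = 0
  jacobian_zero : (jacobian g).map (fun φ => MvPowerSeries.constantCoeff φ) = B

/-- The linear vector field `x ↦ Bx`. -/
def linearField {𝕜 : Type*} [Field 𝕜] {n : ℕ} (B : Matrix (Fin n) (Fin n) 𝕜) :
    FormalField 𝕜 n :=
  (B.map fun b => (MvPowerSeries.C b : MvPowerSeries (Fin n) 𝕜)).mulVec MvPowerSeries.X

/-- The Lie bracket `[f, g] = Dg · f - Df · g`. -/
def lieBracket {𝕜 : Type*} [Field 𝕜] {n : ℕ} (f g : FormalField 𝕜 n) : FormalField 𝕜 n :=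
  (jacobian g).mulVec f - (jacobian f).mulVec g

/-- The homogeneous part `g_j` of degree `j` of `g`. -/
def homogeneousPart {𝕜 : Type*} [Field 𝕜] {n : ℕ} (j : ℕ) (g : FormalField 𝕜 n) :
    FormalField 𝕜 n :=
  fun i => MvPowerSeries.homogeneousComponent j (g i)

/-- The formal composition `g ∘ Φ` (meaningful when `Φ(0) = 0`). -/
def comp {𝕜 : Type*} [Field 𝕜] {n : ℕ} (g Φ : FormalField 𝕜 n) : FormalField 𝕜 n :=
  fun i => MvPowerSeries.subst Φ (g i)

/-- `Φ` is formally solution-preserving from `ẋ = f(x)` to `ẋ = g(x)`: one has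
`DΦ · f = g ∘ Φ` in formal power series. -/
def IsSolutionPreserving {𝕜 : Type*} [Field 𝕜] {n : ℕ} (Φ f g : FormalField 𝕜 n) : Prop :=
  (jacobian Φ).mulVec f = comp g Φ

/-- A formal vector field `g` with linear part `B` is in Poincaré–Dulac normal form:
`[B_s, g] = 0`. -/
def IsNormalForm {𝕜 : Type*} [Field 𝕜] [PerfectField 𝕜] {n : ℕ}
    (B : Matrix (Fin n) (Fin n) 𝕜) (g : FormalField 𝕜 n) : Prop :=
  lieBracket (linearField (semisimplePart B)) g = 0

end PoincareDulac

end

/-!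
The pair `(Φ, F)` is built degree by degree from `(x, Ax)`. Adding terms `(h, k)` of degree `d` to
`(Φ, F)` changes the defect `DΦ · F - f ∘ Φ` by `k + [A, h]` modulo higher order, so the step
requires solving `k + [A, h] = e` for homogeneous fields of degree `d` with `[A_s, k] = 0`. On those
fields `ad A_s` is semisimple, `ad A_n` is nilpotent and the two commute, whence `ker ad A_s`
contains the generalized kernel of `ad A`; by Fitting's lemma the generalized kernel and the image
of `ad A` span. The statement about `ad` follows from `ad B = L_B ⊗ 1 - 1 ⊗ B`, where the derivation
`L_B φ = Dφ · Bx` is a quotient of `L_B ⊗ 1 + 1 ⊗ Bᵀ` under multiplication of forms of degree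
`d - 1` by linear forms. Hadamard quotients replace partial derivatives in Euler's identity and in
Taylor's formula, so that no integer is inverted.
-/

noncomputable section

namespace PoincareDulac

open MvPowerSeries
open scoped TensorProduct

section Order

variable {σ R : Type*} [CommRing R]

/-- The ideal of the power series all of whose terms have degree at least `d`. -/
def orderIdeal (σ R : Type*) [CommRing R] (d : ℕ) : Ideal (MvPowerSeries σ R) where
  carrier := {φ | (d : ℕ∞) ≤ φ.order}
  add_mem' ha hb := (le_min ha hb).trans min_order_le_add
  zero_mem' := by simp
  smul_mem' c _ hφ := (hφ.trans le_add_self).trans (le_order_mul (f := c))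

theorem mem_orderIdeal {d : ℕ} {φ : MvPowerSeries σ R} :
    φ ∈ orderIdeal σ R d ↔ ∀ m : σ →₀ ℕ, m.degree < d → coeff m φ = 0 :=
  ⟨fun h _ hm => coeff_of_lt_order ((Nat.cast_lt.mpr hm).trans_le h), nat_le_order⟩

theorem orderIdeal_anti {d e : ℕ} (h : d ≤ e) : orderIdeal σ R e ≤ orderIdeal σ R d :=
  fun _ hφ => mem_orderIdeal.mpr fun m hm => mem_orderIdeal.mp hφ m (hm.trans_le h)

theorem orderIdeal_zero : orderIdeal σ R 0 = ⊤ :=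
  (Ideal.eq_top_iff_one _).mpr (mem_orderIdeal.mpr fun _ h => absurd h (Nat.not_lt_zero _))

theorem mul_mem_orderIdeal {d e : ℕ} {φ ψ : MvPowerSeries σ R} (hφ : φ ∈ orderIdeal σ R d)
    (hψ : ψ ∈ orderIdeal σ R e) : φ * ψ ∈ orderIdeal σ R (d + e) := by
  change ((d + e : ℕ) : ℕ∞) ≤ _
  rw [Nat.cast_add]
  exact (add_le_add hφ hψ).trans le_order_mul

theorem mem_orderIdeal_one {φ : MvPowerSeries σ R} :
    φ ∈ orderIdeal σ R 1 ↔ constantCoeff φ = 0 := by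
  rw [← one_le_order_iff_constCoeff_eq_zero, ← Nat.cast_one]
  rfl

theorem constantCoeff_pderiv (i : σ) (φ : MvPowerSeries σ R) :
    constantCoeff (pderiv R i φ) = coeff (Finsupp.single i 1) φ := by
  simp [← coeff_zero_eq_constantCoeff_apply, coeff_pderiv]

theorem mem_orderIdeal_two {φ : MvPowerSeries σ R} :
    φ ∈ orderIdeal σ R 2 ↔ constantCoeff φ = 0 ∧ ∀ i, constantCoeff (pderiv R i φ) = 0 := by
  rw [mem_orderIdeal]
  simp only [constantCoeff_pderiv]
  rw [← coeff_zero_eq_constantCoeff_apply]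
  refine ⟨fun h => ⟨h _ (by simp), fun i => h _ (by simp)⟩, fun ⟨h0, h1⟩ m hm => ?_⟩
  obtain h | h : m.degree = 0 ∨ m.degree = 1 := by omega
  · rwa [(Finsupp.degree_eq_zero_iff m).mp h]
  · obtain ⟨i, rfl⟩ := Finsupp.range_single_one.ge h
    exact h1 i

theorem pderiv_mem_orderIdeal {d : ℕ} {φ : MvPowerSeries σ R} (i : σ)
    (hφ : φ ∈ orderIdeal σ R (d + 1)) : pderiv R i φ ∈ orderIdeal σ R d := by
  rw [mem_orderIdeal] at *
  intro m hm
  rw [coeff_pderiv, hφ _ (by simpa using hm), zero_mul]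

theorem eq_zero_of_forall_mem_orderIdeal {φ : MvPowerSeries σ R}
    (h : ∀ d, φ ∈ orderIdeal σ R d) : φ = 0 :=
  MvPowerSeries.ext fun m => mem_orderIdeal.mp (h (m.degree + 1)) m (Nat.lt_succ_self _)

theorem sub_homogeneousComponent_mem_orderIdeal {d : ℕ} {φ : MvPowerSeries σ R}
    (h : φ ∈ orderIdeal σ R d) : φ - homogeneousComponent d φ ∈ orderIdeal σ R (d + 1) := by
  rw [mem_orderIdeal] at *
  intro m hm
  rw [map_sub, coeff_homogeneousComponent]
  split_ifs with hd
  · exact sub_self _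
  · rw [h m (by omega), sub_zero]

theorem homogeneousComponent_eq_of_sub_mem_orderIdeal {d j : ℕ} {φ ψ : MvPowerSeries σ R}
    (h : φ - ψ ∈ orderIdeal σ R d) (hj : j < d) :
    homogeneousComponent j φ = homogeneousComponent j ψ := by
  ext m
  simp only [coeff_homogeneousComponent]
  split_ifs with hm
  · simpa [sub_eq_zero] using mem_orderIdeal.mp h m (hm.trans_lt hj)
  · rfl

theorem exists_limit_of_stabilizing {k : ℕ} (u : ℕ → MvPowerSeries σ R)
    (hu : ∀ d, u (d + 1) - u d ∈ orderIdeal σ R (d + k)) :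
    ∃ φ : MvPowerSeries σ R, ∀ d, φ - u d ∈ orderIdeal σ R (d + k) := by
  have coeff_stable (d e : ℕ) (m : σ →₀ ℕ) (hm : m.degree < d + k) :
      coeff m (u (d + e)) = coeff m (u d) := by
    induction e with
    | zero => rfl
    | succ e ih =>
      rw [← ih, ← sub_eq_zero, ← map_sub]
      exact mem_orderIdeal.mp (hu (d + e)) m (by omega)
  let φ : MvPowerSeries σ R := fun m => coeff m (u (m.degree + 1))
  have coeff_limit (m : σ →₀ ℕ) : coeff m φ = coeff m (u (m.degree + 1)) := rfl
  refine ⟨φ, fun d => mem_orderIdeal.mpr fun m hm => ?_⟩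
  rw [map_sub, sub_eq_zero, coeff_limit, ← coeff_stable (m.degree + 1) d m (by omega), add_comm,
    coeff_stable d _ m hm]

end Order

section Hadamard

variable {σ R : Type*} [CommRing R]

open Classical in
/-- The quotients `q_i` of Hadamard's lemma `φ = φ(0) + ∑ x_i q_i`: here `x_i q_i` collects the
terms of `φ` whose first variable, in a fixed well-order, is `x_i`. -/
def hadamardQuotient (i : σ) (φ : MvPowerSeries σ R) : MvPowerSeries σ R :=
  fun m => if ∀ k, WellOrderingRel k i → m k = 0 then coeff (m + Finsupp.single i 1) φ else 0

open Classical in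
theorem coeff_hadamardQuotient (i : σ) (φ : MvPowerSeries σ R) (m : σ →₀ ℕ) :
    coeff m (hadamardQuotient i φ) =
      if ∀ k, WellOrderingRel k i → m k = 0 then coeff (m + Finsupp.single i 1) φ else 0 := rfl

theorem constantCoeff_hadamardQuotient (i : σ) (φ : MvPowerSeries σ R) :
    constantCoeff (hadamardQuotient i φ) = constantCoeff (pderiv R i φ) := by
  rw [constantCoeff_pderiv, ← coeff_zero_eq_constantCoeff_apply, coeff_hadamardQuotient]
  simp

theorem isHomogeneous_hadamardQuotient {d : ℕ} {φ : MvPowerSeries σ R}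
    (h : φ.IsHomogeneous (d + 1)) (i : σ) : (hadamardQuotient i φ).IsHomogeneous d := by
  classical
  intro m hm
  rw [coeff_hadamardQuotient] at hm
  simpa [Finsupp.weight_single] using h (ite_ne_right_iff.mp hm).2

open Classical in
theorem coeff_X_mul_hadamardQuotient (i : σ) (φ : MvPowerSeries σ R) (m : σ →₀ ℕ) :
    coeff m (X i * hadamardQuotient i φ) =
      if m i ≠ 0 ∧ ∀ k, WellOrderingRel k i → m k = 0 then coeff m φ else 0 := by
  have single_le_iff : Finsupp.single i 1 ≤ m ↔ m i ≠ 0 := by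
    rw [Finsupp.single_le_iff, Nat.one_le_iff_ne_zero]
  rw [X, coeff_monomial_mul, one_mul, ite_and]
  refine if_ctx_congr single_le_iff (fun hi => ?_) fun _ => rfl
  rw [coeff_hadamardQuotient, tsub_add_cancel_of_le (single_le_iff.mpr hi)]
  refine if_congr (forall₂_congr fun k hk => ?_) rfl rfl
  simp [ne_of_irrefl hk]

theorem eq_C_add_sum_X_mul_hadamardQuotient [Fintype σ] (φ : MvPowerSeries σ R) :
    φ = C (constantCoeff φ) + ∑ i, X i * hadamardQuotient i φ := by
  classical
  ext m
  simp only [map_add, map_sum, coeff_C, coeff_X_mul_hadamardQuotient]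
  by_cases hm : m = 0
  · simp [hm]
  obtain ⟨i, hi, first⟩ := WellOrderingRel.isWellOrder.wf.has_min {i | m i ≠ 0}
    (Finsupp.ne_iff.mp hm)
  rw [if_neg hm, zero_add, Finset.sum_eq_single i]
  · exact (if_pos ⟨hi, fun k hk => by_contra fun h => first k h hk⟩).symm
  · exact fun k _ hk => if_neg fun ⟨h, first'⟩ => hk <|
      Std.Trichotomous.trichotomous (r := WellOrderingRel) k i (first k h) (hi <| first' i ·)
  · exact fun h => absurd (Finset.mem_univ i) h

end Hadamard

section Substitution

variable {σ τ R : Type*} [CommRing R] {a b : σ → MvPowerSeries τ R}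

theorem subst_eq_C_add_sum [Fintype σ] (ha : ∀ i, a i ∈ orderIdeal τ R 1) (φ : MvPowerSeries σ R) :
    subst a φ = C (constantCoeff φ) + ∑ i, a i * subst a (hadamardQuotient i φ) := by
  have hs : HasSubst a := hasSubst_of_constantCoeff_zero fun i => mem_orderIdeal_one.mp (ha i)
  conv_lhs => rw [eq_C_add_sum_X_mul_hadamardQuotient φ]
  rw [← coe_substAlgHom hs, map_add, map_sum, coe_substAlgHom hs, subst_C]
  simp only [← coe_substAlgHom hs, map_mul, substAlgHom_X]

theorem subst_sub_subst_mem_orderIdeal [Finite σ] {d : ℕ} (ha : ∀ i, a i ∈ orderIdeal τ R 1)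
    (hb : ∀ i, b i ∈ orderIdeal τ R 1) (h : ∀ i, b i - a i ∈ orderIdeal τ R d)
    (φ : MvPowerSeries σ R) : subst b φ - subst a φ ∈ orderIdeal τ R d := by
  have := Fintype.ofFinite σ
  induction d generalizing φ with
  | zero => exact orderIdeal_zero (σ := τ) (R := R) ▸ Submodule.mem_top
  | succ d ih =>
    rw [subst_eq_C_add_sum ha φ, subst_eq_C_add_sum hb φ, add_sub_add_left_eq_sub,
      ← Finset.sum_sub_distrib]
    refine Ideal.sum_mem _ fun i _ => ?_
    have split : b i * subst b (hadamardQuotient i φ) - a i * subst a (hadamardQuotient i φ) =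
        (b i - a i) * subst b (hadamardQuotient i φ) +
        a i * (subst b (hadamardQuotient i φ) - subst a (hadamardQuotient i φ)) := by ring
    rw [split]
    refine add_mem (Ideal.mul_mem_right _ _ (h i)) (add_comm d 1 ▸ mul_mem_orderIdeal (ha i) ?_)
    exact ih (fun i => orderIdeal_anti d.le_succ (h i)) _

theorem subst_sub_subst_sub_sum_mem_orderIdeal [Fintype σ] {d : ℕ}
    (ha : ∀ i, a i ∈ orderIdeal τ R 1)
    (hb : ∀ i, b i ∈ orderIdeal τ R 1) (h : ∀ i, b i - a i ∈ orderIdeal τ R d)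
    (φ : MvPowerSeries σ R) :
    subst b φ - subst a φ - ∑ i, C (constantCoeff (pderiv R i φ)) * (b i - a i) ∈
      orderIdeal τ R (d + 1) := by
  rw [subst_eq_C_add_sum ha φ, subst_eq_C_add_sum hb φ, add_sub_add_left_eq_sub,
    ← Finset.sum_sub_distrib, ← Finset.sum_sub_distrib]
  refine Ideal.sum_mem _ fun i _ => ?_
  have split : b i * subst b (hadamardQuotient i φ) - a i * subst a (hadamardQuotient i φ) -
        C (constantCoeff (pderiv R i φ)) * (b i - a i) =
      (b i - a i) * (subst b (hadamardQuotient i φ) - C (constantCoeff (pderiv R i φ))) +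
      a i * (subst b (hadamardQuotient i φ) - subst a (hadamardQuotient i φ)) := by ring
  have remainder_mem : subst b (hadamardQuotient i φ) - C (constantCoeff (pderiv R i φ)) ∈
      orderIdeal τ R 1 := by
    rw [subst_eq_C_add_sum hb, constantCoeff_hadamardQuotient, add_sub_cancel_left]
    exact Ideal.sum_mem _ fun j _ => Ideal.mul_mem_right _ _ (hb j)
  rw [split]
  exact add_mem (mul_mem_orderIdeal (h i) remainder_mem)
    (add_comm d 1 ▸ mul_mem_orderIdeal (ha i) (subst_sub_subst_mem_orderIdeal ha hb h _))

end Substitution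

section LinearAlgebra

open Module Polynomial

/-- A pair of commuting endomorphisms, the first semisimple and the second nilpotent: the two parts
of a Jordan–Chevalley decomposition of their sum. -/
structure IsJordanPair {R V : Type*} [CommRing R] [AddCommGroup V] [Module R V]
    (s ν : End R V) : Prop where
  isSemisimple : s.IsSemisimple
  isNilpotent : IsNilpotent ν
  commute : Commute s ν

section Surjective

variable {R V W : Type*} [CommRing R] [AddCommGroup V] [Module R V] [AddCommGroup W] [Module R W]
  {π : V →ₗ[R] W}

theorem isSemisimple_of_surjective {s : End R V} {s' : End R W} (hs : s.IsSemisimple)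
    (hπ : Function.Surjective π) (h : π ∘ₗ s = s' ∘ₗ π) : s'.IsSemisimple := by
  let π' : AEval' s →ₗ[R[X]] AEval' s' := LinearMap.ofAEval _ ((AEval'.of s').toLinearMap ∘ₗ π)
    fun v => by simpa [AEval'.X_smul_of] using LinearMap.congr_fun h v
  have : IsSemisimpleModule R[X] (AEval' s) := hs
  refine IsSemisimpleModule.of_surjective π' fun w => ?_
  obtain ⟨v, hv⟩ := hπ ((AEval'.of s').symm w)
  exact ⟨AEval'.of s v, by simp [π', LinearMap.ofAEval, hv]⟩

theorem isNilpotent_of_surjective {ν : End R V} {ν' : End R W} (hν : IsNilpotent ν)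
    (hπ : Function.Surjective π) (h : π ∘ₗ ν = ν' ∘ₗ π) : IsNilpotent ν' := by
  obtain ⟨k, hk⟩ := hν
  refine ⟨k, (LinearMap.cancel_right hπ).mp ?_⟩
  rw [Module.End.commute_pow_left_of_commute h.symm k, hk, LinearMap.comp_zero,
    LinearMap.zero_comp]

theorem IsJordanPair.of_surjective {s ν : End R V} {s' ν' : End R W} (h : IsJordanPair s ν)
    (hπ : Function.Surjective π) (hs : π ∘ₗ s = s' ∘ₗ π) (hν : π ∘ₗ ν = ν' ∘ₗ π) :
    IsJordanPair s' ν' where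
  isSemisimple := isSemisimple_of_surjective h.isSemisimple hπ hs
  isNilpotent := isNilpotent_of_surjective h.isNilpotent hπ hν
  commute := (LinearMap.cancel_right hπ).mp <| calc
    (s' ∘ₗ ν') ∘ₗ π = π ∘ₗ (s * ν) := by
      rw [LinearMap.comp_assoc, ← hν, ← LinearMap.comp_assoc, ← hs]; rfl
    _ = π ∘ₗ (ν * s) := by rw [h.commute.eq]
    _ = (ν' ∘ₗ s') ∘ₗ π := by
      rw [LinearMap.comp_assoc, ← hs, ← LinearMap.comp_assoc, ← hν]; rfl

theorem IsJordanPair.neg {s ν : End R V} (h : IsJordanPair s ν) : IsJordanPair (-s) (-ν) where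
  isSemisimple := Module.End.isSemisimple_neg.mpr h.isSemisimple
  isNilpotent := h.isNilpotent.neg
  commute := h.commute.neg_left.neg_right

/-- The endomorphism `s ⊗ 1 + 1 ⊗ t` of `V ⊗ W`. -/
def tensorSum (s : End R V) (t : End R W) : End R (V ⊗[R] W) := s.rTensor W + t.lTensor V

theorem commute_rTensor_lTensor (s : End R V) (t : End R W) :
    Commute (s.rTensor W) (t.lTensor V) :=
  (LinearMap.rTensor_comp_lTensor ..).trans (LinearMap.lTensor_comp_rTensor ..).symm

theorem tensorSum_add (s ν : End R V) (t μ : End R W) :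
    tensorSum s t + tensorSum ν μ = tensorSum (s + ν) (t + μ) := by
  simp only [tensorSum, LinearMap.rTensor_add, LinearMap.lTensor_add]
  abel

end Surjective

variable {K V W : Type*} [Field K] [AddCommGroup V] [Module K V] [AddCommGroup W] [Module K W]

theorem isSemisimple_algHom_apply [FiniteDimensional K V] {s : End K V} (hs : s.IsSemisimple)
    (F : End K V →ₐ[K] End K W) : (F s).IsSemisimple :=
  Module.End.isSemisimple_of_squarefree_aeval_eq_zero hs.minpoly_squarefree
    (by rw [aeval_algHom_apply, minpoly.aeval, map_zero])

theorem IsJordanPair.tensorSum [PerfectField K] [FiniteDimensional K V] [FiniteDimensional K W]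
    {s ν : End K V} {t μ : End K W} (h : IsJordanPair s ν) (h' : IsJordanPair t μ) :
    IsJordanPair (tensorSum s t) (tensorSum ν μ) where
  isSemisimple :=
    (isSemisimple_algHom_apply h.isSemisimple (Module.End.rTensorAlgHom K V W)).add_of_commute
      (commute_rTensor_lTensor s t)
      (isSemisimple_algHom_apply h'.isSemisimple (Module.End.lTensorAlgHom K W V))
  isNilpotent :=
    (commute_rTensor_lTensor ν μ).isNilpotent_add
      (h.isNilpotent.map (Module.End.rTensorAlgHom K V W))
      (h'.isNilpotent.map (Module.End.lTensorAlgHom K W V))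
  commute :=
    ((h.commute.map (Module.End.rTensorAlgHom K V W)).add_right
      (commute_rTensor_lTensor s μ)).add_left
    ((commute_rTensor_lTensor ν t).symm.add_right
      (h'.commute.map (Module.End.lTensorAlgHom K W V)))

/-- Fitting's lemma for `s + ν`, together with the vanishing of `s` on the generalized kernel of
`s + ν`. -/
theorem IsJordanPair.exists_apply_eq_zero_and_add_eq [FiniteDimensional K V] {s ν : End K V}
    (h : IsJordanPair s ν) (v : V) : ∃ k w : V, s k = 0 ∧ k + (s + ν) w = v := by
  obtain ⟨m, hcompl, hm⟩ := ((s + ν).eventually_isCompl_ker_pow_range_pow.and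
    (Filter.eventually_ge_atTop 1)).exists
  obtain ⟨k, hk, _, ⟨w, rfl⟩, rfl⟩ := Submodule.mem_sup.mp
    (hcompl.sup_eq_top ▸ Submodule.mem_top : v ∈ _)
  refine ⟨k, ((s + ν) ^ (m - 1)) w, ?_, ?_⟩
  · have mem_genEigenspace : k ∈ (s + ν).genEigenspace 0 m := by
      simpa [Module.End.mem_genEigenspace_nat] using hk
    simpa using Module.End.apply_eq_of_mem_of_comm_of_isFinitelySemisimple_of_isNil
      mem_genEigenspace ((Commute.refl s).add_left h.commute.symm)
      h.isSemisimple.isFinitelySemisimple (by simpa using h.isNilpotent)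
  · rw [← Module.End.mul_apply, ← pow_succ', Nat.sub_add_cancel hm]

theorem aeval_transpose {ι R : Type*} [Fintype ι] [DecidableEq ι] [CommSemiring R]
    (B : Matrix ι ι R) (p : R[X]) : aeval B.transpose p = (aeval B p).transpose := by
  simp only [aeval_eq_sum_range, Matrix.transpose_sum, Matrix.transpose_smul,
    Matrix.transpose_pow]

theorem isSemisimple_toLin'_transpose {ι : Type*} [Fintype ι] [DecidableEq ι] {S : Matrix ι ι K}
    (hS : Module.End.IsSemisimple (Matrix.toLin' S)) :
    Module.End.IsSemisimple (Matrix.toLin' S.transpose) := by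
  refine Module.End.isSemisimple_of_squarefree_aeval_eq_zero hS.minpoly_squarefree ?_
  change aeval (Matrix.toLinAlgEquiv' S.transpose) _ = 0
  rw [Matrix.minpoly_toLin', aeval_algHom_apply, aeval_transpose, minpoly.aeval,
    Matrix.transpose_zero, map_zero]

variable {n : ℕ} {B S N : Matrix (Fin n) (Fin n) K}

theorem IsJordanChevalley.isJordanPair (h : IsJordanChevalley B S N) :
    IsJordanPair (Matrix.toLin' S) (Matrix.toLin' N) where
  isSemisimple := h.semisimple
  isNilpotent := h.nilpotent.map Matrix.toLinAlgEquiv'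
  commute := h.commute.map Matrix.toLinAlgEquiv'

theorem IsJordanChevalley.transpose (h : IsJordanChevalley B S N) :
    IsJordanChevalley B.transpose S.transpose N.transpose where
  add_eq := by rw [h.add_eq, Matrix.transpose_add]
  semisimple := isSemisimple_toLin'_transpose h.semisimple
  nilpotent := Matrix.isNilpotent_transpose_iff.mpr h.nilpotent
  commute := (h.commute.map (Matrix.transposeAlgEquiv (Fin n) K K)).unop

theorem IsJordanChevalley.commute_left (h : IsJordanChevalley B S N) : Commute S B :=
  h.add_eq ▸ (Commute.refl S).add_right h.commute

end LinearAlgebra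

section Homogeneous

variable {σ R : Type*} [CommRing R]

/-- The module of the power series that are homogeneous of degree `j`. -/
def homogeneousSubmodule (σ R : Type*) [CommRing R] (j : ℕ) : Submodule R (MvPowerSeries σ R) :=
  LinearMap.eqLocus (homogeneousComponent j) LinearMap.id

theorem mem_homogeneousSubmodule {j : ℕ} {φ : MvPowerSeries σ R} :
    φ ∈ homogeneousSubmodule σ R j ↔ φ.IsHomogeneous j := by
  rw [isHomogeneous_iff_eq_homogeneousComponent, eq_comm]
  rfl

theorem homogeneousComponent_mem_homogeneousSubmodule (j : ℕ) (φ : MvPowerSeries σ R) :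
    homogeneousComponent j φ ∈ homogeneousSubmodule σ R j :=
  mem_homogeneousSubmodule.mpr (isHomogeneous_homogeneousComponent φ j)

theorem mem_orderIdeal_of_mem_homogeneousSubmodule {j : ℕ} {φ : MvPowerSeries σ R}
    (h : φ ∈ homogeneousSubmodule σ R j) : φ ∈ orderIdeal σ R j :=
  mem_orderIdeal.mpr fun _ hm => IsHomogeneous.coeff_eq_zero (mem_homogeneousSubmodule.mp h) hm.ne

theorem mul_mem_homogeneousSubmodule {j k : ℕ} {φ ψ : MvPowerSeries σ R}
    (hφ : φ ∈ homogeneousSubmodule σ R j) (hψ : ψ ∈ homogeneousSubmodule σ R k) :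
    φ * ψ ∈ homogeneousSubmodule σ R (j + k) := by
  rw [mem_homogeneousSubmodule] at *
  exact hφ.mul hψ

theorem one_mem_homogeneousSubmodule : 1 ∈ homogeneousSubmodule σ R 0 := by
  classical
  refine mem_homogeneousSubmodule.mpr fun {m} hm => ?_
  rw [coeff_one] at hm
  rw [(ite_ne_right_iff.mp hm).1, map_zero]

theorem eq_C_of_mem_homogeneousSubmodule_zero {φ : MvPowerSeries σ R}
    (h : φ ∈ homogeneousSubmodule σ R 0) : φ = C (constantCoeff φ) := by
  classical
  ext m
  rw [coeff_C]
  split_ifs with hm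
  · rw [hm, coeff_zero_eq_constantCoeff_apply]
  · exact IsHomogeneous.coeff_eq_zero (mem_homogeneousSubmodule.mp h)
      fun h' => hm ((Finsupp.degree_eq_zero_iff m).mp h')

theorem X_mem_homogeneousSubmodule (i : σ) : X i ∈ homogeneousSubmodule σ R 1 := by
  classical
  refine mem_homogeneousSubmodule.mpr fun {m} hm => ?_
  rw [coeff_X] at hm
  simp [(ite_ne_right_iff.mp hm).1, Finsupp.weight_single]

theorem homogeneousComponent_X_mul_pderiv (j : ℕ) (l k : σ) (φ : MvPowerSeries σ R) :
    homogeneousComponent j (X l * pderiv R k φ) = X l * pderiv R k (homogeneousComponent j φ) := by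
  classical
  ext m
  simp only [coeff_homogeneousComponent, X, coeff_monomial_mul, one_mul, coeff_pderiv]
  by_cases hl : Finsupp.single l 1 ≤ m
  · have degree_eq : (m - Finsupp.single l 1 + Finsupp.single k 1).degree = m.degree := by
      conv_rhs => rw [← tsub_add_cancel_of_le hl]
      simp
    simp only [if_pos hl, degree_eq, ite_mul, zero_mul]
  · simp only [if_neg hl, ite_self]

theorem homogeneousComponent_C_mul (j : ℕ) (c : R) (φ : MvPowerSeries σ R) :
    homogeneousComponent j (C c * φ) = C c * homogeneousComponent j φ := by
  rw [← smul_eq_C_mul, map_smul, smul_eq_C_mul]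

/-- The linear form `v ↦ ∑ v_i x_i`. -/
def linearForm (σ R : Type*) [CommRing R] [Fintype σ] : (σ → R) →ₗ[R] MvPowerSeries σ R :=
  Fintype.linearCombination R X

theorem linearForm_apply [Fintype σ] (v : σ → R) : linearForm σ R v = ∑ i, C (v i) * X i := by
  simp only [linearForm, Fintype.linearCombination_apply, smul_eq_C_mul]

theorem linearForm_mem_homogeneousSubmodule [Fintype σ] (v : σ → R) :
    linearForm σ R v ∈ homogeneousSubmodule σ R 1 :=
  Submodule.sum_mem _ fun i _ => Submodule.smul_mem _ (v i) (X_mem_homogeneousSubmodule i)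

/-- Multiplication of homogeneous power series by linear forms. -/
def mulLinearForm (σ R : Type*) [CommRing R] [Fintype σ] (j : ℕ) :
    homogeneousSubmodule σ R j ⊗[R] (σ → R) →ₗ[R] homogeneousSubmodule σ R (j + 1) :=
  TensorProduct.lift <| LinearMap.mk₂ R
    (fun φ v => ⟨φ * linearForm σ R v,
      mul_mem_homogeneousSubmodule φ.2 (linearForm_mem_homogeneousSubmodule v)⟩)
    (fun _ _ _ => Subtype.ext (add_mul _ _ _))
    (fun _ _ _ => Subtype.ext (smul_mul_assoc _ _ _))
    (fun _ _ _ => Subtype.ext (by simp [mul_add]))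
    (fun _ _ _ => Subtype.ext (by simp))

theorem coe_mulLinearForm_tmul [Fintype σ] {j : ℕ} (φ : homogeneousSubmodule σ R j) (v : σ → R) :
    (mulLinearForm σ R j (φ ⊗ₜ v) : MvPowerSeries σ R) = φ * linearForm σ R v := rfl

theorem mulLinearForm_surjective [Fintype σ] (j : ℕ) :
    Function.Surjective (mulLinearForm σ R j) := by
  classical
  rintro ⟨φ, hφ⟩
  have constantCoeff_eq_zero : constantCoeff φ = 0 := mem_orderIdeal_one.mp
    (orderIdeal_anti j.succ_pos (mem_orderIdeal_of_mem_homogeneousSubmodule hφ))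
  refine ⟨∑ i, ⟨hadamardQuotient i φ, mem_homogeneousSubmodule.mpr
    (isHomogeneous_hadamardQuotient (mem_homogeneousSubmodule.mp hφ) i)⟩ ⊗ₜ Pi.single i 1,
    Subtype.ext ?_⟩
  refine Eq.trans ?_ (eq_C_add_sum_X_mul_hadamardQuotient φ).symm
  simp [coe_mulLinearForm_tmul, linearForm, constantCoeff_eq_zero, mul_comm]

instance finite_homogeneousSubmodule [Finite σ] (j : ℕ) :
    Module.Finite R (homogeneousSubmodule σ R j) := by
  have := Fintype.ofFinite σ
  induction j with
  | zero =>
    let ofScalar : R →ₗ[R] homogeneousSubmodule σ R 0 :=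
      LinearMap.toSpanSingleton R _ ⟨1, one_mem_homogeneousSubmodule⟩
    refine Module.Finite.of_surjective ofScalar fun φ => ⟨constantCoeff φ.1, Subtype.ext ?_⟩
    rw [eq_C_of_mem_homogeneousSubmodule_zero φ.2]
    simp [ofScalar, smul_eq_C_mul]
  | succ j ih => exact Module.Finite.of_surjective _ (mulLinearForm_surjective j)

end Homogeneous

section LinearField

variable {n : ℕ} {𝕜 : Type*} [Field 𝕜]

theorem linearField_apply (B : Matrix (Fin n) (Fin n) 𝕜) (i : Fin n) :
    linearField B i = ∑ l, C (B i l) * X l := rfl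

theorem linearField_eq_linearForm (B : Matrix (Fin n) (Fin n) 𝕜) (i : Fin n) :
    linearField B i = linearForm (Fin n) 𝕜 (B i) :=
  (linearForm_apply (B i)).symm

theorem linearField_one : linearField (1 : Matrix (Fin n) (Fin n) 𝕜) = X := by
  ext1 i
  simp [linearField_apply, Matrix.one_apply, apply_ite C]

theorem linearField_add (B B' : Matrix (Fin n) (Fin n) 𝕜) :
    linearField (B + B') = linearField B + linearField B' := by
  ext1 i
  simp [linearField_apply, add_mul, Finset.sum_add_distrib]

theorem jacobian_linearField (B : Matrix (Fin n) (Fin n) 𝕜) :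
    jacobian (linearField B) = B.map C := by
  classical
  ext1 i k
  rw [jacobian, Matrix.of_apply, linearField_apply, map_sum]
  simp [Derivation.leibniz, pderiv_X, Pi.single_apply]

/-- The derivation `φ ↦ Dφ · Bx`. -/
def linearDerivation (B : Matrix (Fin n) (Fin n) 𝕜) :
    Derivation 𝕜 (MvPowerSeries (Fin n) 𝕜) (MvPowerSeries (Fin n) 𝕜) :=
  ∑ k, linearField B k • pderiv 𝕜 k

theorem linearDerivation_apply (B : Matrix (Fin n) (Fin n) 𝕜) (φ : MvPowerSeries (Fin n) 𝕜) :
    linearDerivation B φ = ∑ k, linearField B k * pderiv 𝕜 k φ := by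
  have := congrFun (map_sum (Derivation.coeFnAddMonoidHom (R := 𝕜)
    (A := MvPowerSeries (Fin n) 𝕜) (M := MvPowerSeries (Fin n) 𝕜))
    (fun k => linearField B k • pderiv 𝕜 k) Finset.univ) φ
  rwa [Finset.sum_apply] at this

theorem linearDerivation_add (B B' : Matrix (Fin n) (Fin n) 𝕜) :
    linearDerivation (B + B') = linearDerivation B + linearDerivation B' := by
  simp [linearDerivation, linearField_add, add_smul, Finset.sum_add_distrib]

theorem linearDerivation_C (B : Matrix (Fin n) (Fin n) 𝕜) (c : 𝕜) :
    linearDerivation B (C c) = 0 := by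
  simp [linearDerivation_apply]

theorem linearDerivation_X (B : Matrix (Fin n) (Fin n) 𝕜) (i : Fin n) :
    linearDerivation B (X i) = linearForm (Fin n) 𝕜 (B i) := by
  classical
  simp [linearDerivation_apply, pderiv_X, Pi.single_apply, linearField_eq_linearForm]

theorem linearDerivation_linearForm (B : Matrix (Fin n) (Fin n) 𝕜) (v : Fin n → 𝕜) :
    linearDerivation B (linearForm (Fin n) 𝕜 v) =
      linearForm (Fin n) 𝕜 (B.transpose.mulVec v) := calc
  linearDerivation B (linearForm (Fin n) 𝕜 v) = ∑ i, v i • linearDerivation B (X i) := by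
    simp only [linearForm, Fintype.linearCombination_apply, map_sum, Derivation.map_smul]
  _ = linearForm (Fin n) 𝕜 (∑ i, v i • B i) := by
    simp only [linearDerivation_X, map_sum, map_smul]
  _ = linearForm (Fin n) 𝕜 (B.transpose.mulVec v) := by
    rw [Matrix.mulVec_transpose, Matrix.vecMul_eq_sum]

theorem homogeneousComponent_linearDerivation (j : ℕ) (B : Matrix (Fin n) (Fin n) 𝕜)
    (φ : MvPowerSeries (Fin n) 𝕜) :
    homogeneousComponent j (linearDerivation B φ) =
      linearDerivation B (homogeneousComponent j φ) := by
  simp only [linearDerivation_apply, linearField_apply, Finset.sum_mul, map_sum, mul_assoc,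
    homogeneousComponent_C_mul, homogeneousComponent_X_mul_pderiv]

theorem linearDerivation_mem_homogeneousSubmodule (B : Matrix (Fin n) (Fin n) 𝕜) {j : ℕ}
    {φ : MvPowerSeries (Fin n) 𝕜} (h : φ ∈ homogeneousSubmodule (Fin n) 𝕜 j) :
    linearDerivation B φ ∈ homogeneousSubmodule (Fin n) 𝕜 j :=
  (homogeneousComponent_linearDerivation j B φ).trans (congrArg (linearDerivation B) h)

theorem lieBracket_linearField_apply (B : Matrix (Fin n) (Fin n) 𝕜) (g : FormalField 𝕜 n)
    (i : Fin n) :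
    lieBracket (linearField B) g i = linearDerivation B (g i) - ∑ l, C (B i l) * g l := by
  rw [lieBracket, jacobian_linearField, linearDerivation_apply]
  simp only [Pi.sub_apply, Matrix.mulVec, dotProduct, jacobian, Matrix.of_apply, mul_comm,
    Matrix.map_apply]

theorem homogeneousPart_lieBracket_linearField (j : ℕ) (B : Matrix (Fin n) (Fin n) 𝕜)
    (g : FormalField 𝕜 n) :
    homogeneousPart j (lieBracket (linearField B) g) =
      lieBracket (linearField B) (homogeneousPart j g) := by
  ext1 i
  simp only [homogeneousPart, lieBracket_linearField_apply, map_sub, map_sum,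
    homogeneousComponent_linearDerivation, homogeneousComponent_C_mul]

theorem lieBracket_linearField_linearField {B B' : Matrix (Fin n) (Fin n) 𝕜}
    (h : Commute B B') : lieBracket (linearField B) (linearField B') = 0 := by
  have coefficients_commute : Commute (B.map C) (B'.map C : Matrix _ _ (MvPowerSeries _ 𝕜)) :=
    h.map (C (σ := Fin n)).mapMatrix
  rw [lieBracket, jacobian_linearField, jacobian_linearField, linearField, linearField,
    Matrix.mulVec_mulVec, Matrix.mulVec_mulVec]
  exact sub_eq_zero_of_eq (congrArg (Matrix.mulVec · X) coefficients_commute.eq.symm)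

theorem jacobian_add (g h : FormalField 𝕜 n) : jacobian (g + h) = jacobian g + jacobian h :=
  Matrix.ext fun i j => map_add (pderiv 𝕜 j) (g i) (h i)

theorem lieBracket_add_right (f g h : FormalField 𝕜 n) :
    lieBracket f (g + h) = lieBracket f g + lieBracket f h := by
  rw [lieBracket, jacobian_add, Matrix.add_mulVec, Matrix.mulVec_add, lieBracket, lieBracket]
  abel

end LinearField

section HomologicalEquation

variable {n : ℕ} {𝕜 : Type*} [Field 𝕜]

/-- The action of `linearDerivation B` on the homogeneous power series of degree `j`. -/
def homogeneousDerivation (j : ℕ) (B : Matrix (Fin n) (Fin n) 𝕜) :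
    Module.End 𝕜 (homogeneousSubmodule (Fin n) 𝕜 j) :=
  (linearDerivation B).toLinearMap.restrict fun _ => linearDerivation_mem_homogeneousSubmodule B

theorem coe_homogeneousDerivation (j : ℕ) (B : Matrix (Fin n) (Fin n) 𝕜)
    (φ : homogeneousSubmodule (Fin n) 𝕜 j) :
    (homogeneousDerivation j B φ : MvPowerSeries (Fin n) 𝕜) = linearDerivation B φ := rfl

theorem homogeneousDerivation_zero (B : Matrix (Fin n) (Fin n) 𝕜) :
    homogeneousDerivation 0 B = 0 := by
  ext1 φ
  refine Subtype.ext ?_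
  rw [coe_homogeneousDerivation, eq_C_of_mem_homogeneousSubmodule_zero φ.2, linearDerivation_C]
  rfl

theorem homogeneousDerivation_add (j : ℕ) (B B' : Matrix (Fin n) (Fin n) 𝕜) :
    homogeneousDerivation j (B + B') = homogeneousDerivation j B + homogeneousDerivation j B' := by
  ext1 φ
  exact Subtype.ext (DFunLike.congr_fun (linearDerivation_add B B') φ.1)

theorem mulLinearForm_comp_tensorSum (j : ℕ) (B : Matrix (Fin n) (Fin n) 𝕜) :
    mulLinearForm (Fin n) 𝕜 j ∘ₗ
        tensorSum (homogeneousDerivation j B) (Matrix.toLin' B.transpose) =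
      homogeneousDerivation (j + 1) B ∘ₗ mulLinearForm (Fin n) 𝕜 j := by
  refine TensorProduct.ext' fun φ v => Subtype.ext ?_
  simp only [tensorSum, LinearMap.comp_apply, LinearMap.add_apply, LinearMap.rTensor_tmul,
    LinearMap.lTensor_tmul, map_add, Submodule.coe_add, coe_mulLinearForm_tmul,
    coe_homogeneousDerivation, Derivation.leibniz, linearDerivation_linearForm,
    Matrix.toLin'_apply, smul_eq_mul]
  ring

theorem IsJordanChevalley.homogeneousDerivation [PerfectField 𝕜]
    {B S N : Matrix (Fin n) (Fin n) 𝕜} (h : IsJordanChevalley B S N) (j : ℕ) :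
    IsJordanPair (homogeneousDerivation j S) (homogeneousDerivation j N) := by
  induction j with
  | zero =>
    rw [homogeneousDerivation_zero, homogeneousDerivation_zero]
    exact ⟨Module.End.isSemisimple_zero, IsNilpotent.zero, Commute.zero_left 0⟩
  | succ j ih =>
    exact (ih.tensorSum h.transpose.isJordanPair).of_surjective (mulLinearForm_surjective j)
      (mulLinearForm_comp_tensorSum j S) (mulLinearForm_comp_tensorSum j N)

/-- The identification of the tensor `φ ⊗ v` with the homogeneous vector field `x ↦ φ(x) v`. -/
def tensorField (n : ℕ) (𝕜 : Type*) [Field 𝕜] (j : ℕ) :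
    homogeneousSubmodule (Fin n) 𝕜 j ⊗[𝕜] (Fin n → 𝕜) →ₗ[𝕜] FormalField 𝕜 n :=
  (homogeneousSubmodule (Fin n) 𝕜 j).subtype.compLeft (Fin n) ∘ₗ
    (TensorProduct.piScalarRight 𝕜 𝕜 _ (Fin n)).toLinearMap

theorem tensorField_tmul {j : ℕ} (φ : homogeneousSubmodule (Fin n) 𝕜 j) (v : Fin n → 𝕜)
    (i : Fin n) : tensorField n 𝕜 j (φ ⊗ₜ v) i = C (v i) * (φ : MvPowerSeries (Fin n) 𝕜) := by
  simp [tensorField, smul_eq_C_mul]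

theorem tensorField_mem {j : ℕ} (u : homogeneousSubmodule (Fin n) 𝕜 j ⊗[𝕜] (Fin n → 𝕜))
    (i : Fin n) : tensorField n 𝕜 j u i ∈ homogeneousSubmodule (Fin n) 𝕜 j :=
  Subtype.property _

theorem exists_tensorField_eq {j : ℕ} {g : FormalField 𝕜 n}
    (hg : ∀ i, g i ∈ homogeneousSubmodule (Fin n) 𝕜 j) : ∃ u, tensorField n 𝕜 j u = g :=
  ⟨(TensorProduct.piScalarRight 𝕜 𝕜 _ (Fin n)).symm fun i => ⟨g i, hg i⟩,
    funext fun i => by simp [tensorField]⟩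

theorem lieBracket_linearField_tensorField {j : ℕ} (B : Matrix (Fin n) (Fin n) 𝕜)
    (u : homogeneousSubmodule (Fin n) 𝕜 j ⊗[𝕜] (Fin n → 𝕜)) :
    lieBracket (linearField B) (tensorField n 𝕜 j u) =
      tensorField n 𝕜 j (tensorSum (homogeneousDerivation j B) (-Matrix.toLin' B) u) := by
  induction u with
  | zero =>
    ext1 i
    simp [lieBracket_linearField_apply]
  | add u w hu hw => rw [map_add, map_add, map_add, lieBracket_add_right, hu, hw]
  | tmul φ v =>
    ext1 i
    simp only [tensorSum, LinearMap.add_apply, LinearMap.rTensor_tmul, LinearMap.lTensor_tmul,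
      map_add, Pi.add_apply, lieBracket_linearField_apply, tensorField_tmul,
      coe_homogeneousDerivation, Derivation.leibniz, linearDerivation_C, LinearMap.neg_apply,
      Pi.neg_apply, Matrix.toLin'_apply, Matrix.mulVec, dotProduct, map_neg, map_sum, map_mul,
      smul_eq_mul, ← mul_assoc, ← Finset.sum_mul]
    ring

theorem exists_homological_solution [PerfectField 𝕜] {A S N : Matrix (Fin n) (Fin n) 𝕜}
    (hA : IsJordanChevalley A S N) (j : ℕ) {e : FormalField 𝕜 n}
    (he : ∀ i, e i ∈ homogeneousSubmodule (Fin n) 𝕜 j) :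
    ∃ k h : FormalField 𝕜 n, (∀ i, k i ∈ homogeneousSubmodule (Fin n) 𝕜 j) ∧
      (∀ i, h i ∈ homogeneousSubmodule (Fin n) 𝕜 j) ∧ lieBracket (linearField S) k = 0 ∧
      k + lieBracket (linearField A) h = e := by
  obtain ⟨u, rfl⟩ := exists_tensorField_eq he
  obtain ⟨k, h, hk, hkh⟩ := ((hA.homogeneousDerivation j).tensorSum
    hA.isJordanPair.neg).exists_apply_eq_zero_and_add_eq u
  refine ⟨tensorField n 𝕜 j k, tensorField n 𝕜 j h, tensorField_mem k, tensorField_mem h, ?_, ?_⟩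
  · rw [lieBracket_linearField_tensorField, hk, map_zero]
  · rw [lieBracket_linearField_tensorField, ← map_add, ← hkh, tensorSum_add, ← neg_add,
      ← map_add Matrix.toLin', ← homogeneousDerivation_add, ← hA.add_eq]

end HomologicalEquation

section Defect

variable {n : ℕ} {𝕜 : Type*} [Field 𝕜] {A B : Matrix (Fin n) (Fin n) 𝕜}
  {f g h k Φ F : FormalField 𝕜 n}

theorem hasLinearPart_iff :
    HasLinearPart g B ↔ ∀ i, g i - linearField B i ∈ orderIdeal (Fin n) 𝕜 2 := by
  have pderiv_linearField (i l : Fin n) : pderiv 𝕜 l (linearField B i) = C (B i l) :=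
    congrFun (congrFun (jacobian_linearField B) i) l
  have constantCoeff_linearField (i : Fin n) : constantCoeff (linearField B i) = 0 := by
    simp [linearField_apply]
  simp only [mem_orderIdeal_two, map_sub, pderiv_linearField, constantCoeff_linearField, sub_zero,
    constantCoeff_C, sub_eq_zero, forall_and]
  exact ⟨fun hg => ⟨hg.map_zero, fun i l => congrFun (congrFun hg.jacobian_zero i) l⟩,
    fun hg => ⟨hg.1, Matrix.ext hg.2⟩⟩

theorem hasLinearPart_linearField (B : Matrix (Fin n) (Fin n) 𝕜) :
    HasLinearPart (linearField B) B :=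
  hasLinearPart_iff.mpr fun i => sub_self (linearField B i) ▸ zero_mem _

theorem HasLinearPart.mem_orderIdeal_one (hg : HasLinearPart g B) (i : Fin n) :
    g i ∈ orderIdeal (Fin n) 𝕜 1 :=
  PoincareDulac.mem_orderIdeal_one.mpr (hg.map_zero i)

theorem HasLinearPart.of_sub_mem (hg : HasLinearPart g B)
    (h : ∀ i, f i - g i ∈ orderIdeal (Fin n) 𝕜 2) : HasLinearPart f B :=
  hasLinearPart_iff.mpr fun i => sub_add_sub_cancel (f i) (g i) _ ▸
    add_mem (h i) (hasLinearPart_iff.mp hg i)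

theorem mulVec_mem_orderIdeal {ι κ σ R : Type*} [Fintype κ] [CommRing R]
    {M : Matrix ι κ (MvPowerSeries σ R)} {v : κ → MvPowerSeries σ R} {d e : ℕ}
    (hM : ∀ i l, M i l ∈ orderIdeal σ R d) (hv : ∀ l, v l ∈ orderIdeal σ R e) (i : ι) :
    M.mulVec v i ∈ orderIdeal σ R (d + e) := by
  rw [Matrix.mulVec, dotProduct]
  exact Ideal.sum_mem _ fun l _ => mul_mem_orderIdeal (hM i l) (hv l)

theorem jacobian_mem_orderIdeal {d : ℕ} (hg : ∀ i, g i ∈ orderIdeal (Fin n) 𝕜 (d + 1))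
    (i l : Fin n) : jacobian g i l ∈ orderIdeal (Fin n) 𝕜 d :=
  pderiv_mem_orderIdeal l (hg i)

theorem jacobian_sub_one_mem_orderIdeal (hΦ : HasLinearPart Φ 1) (i l : Fin n) :
    (jacobian Φ - 1) i l ∈ orderIdeal (Fin n) 𝕜 1 := by
  have constantCoeff_jacobian :
      constantCoeff (jacobian Φ i l) = (1 : Matrix (Fin n) (Fin n) 𝕜) i l :=
    congrFun (congrFun hΦ.jacobian_zero i) l
  rw [mem_orderIdeal_one, Matrix.sub_apply, map_sub, constantCoeff_jacobian, sub_eq_zero]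
  simp only [Matrix.one_apply, apply_ite constantCoeff, map_one, map_zero]

theorem lieBracket_mem_orderIdeal {d : ℕ} (hf : ∀ i, f i ∈ orderIdeal (Fin n) 𝕜 1)
    (hg : ∀ i, g i ∈ orderIdeal (Fin n) 𝕜 (d + 1)) (i : Fin n) :
    lieBracket f g i ∈ orderIdeal (Fin n) 𝕜 (d + 1) :=
  sub_mem (mulVec_mem_orderIdeal (jacobian_mem_orderIdeal hg) hf i)
    (zero_add (d + 1) ▸ mulVec_mem_orderIdeal (jacobian_mem_orderIdeal hf) hg i)

theorem comp_add_sub_comp_sub_mulVec_mem_orderIdeal {d : ℕ} (hf : HasLinearPart f A)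
    (hΦ : ∀ i, Φ i ∈ orderIdeal (Fin n) 𝕜 1) (hh : ∀ i, h i ∈ orderIdeal (Fin n) 𝕜 (d + 1))
    (i : Fin n) :
    (comp f (Φ + h) - comp f Φ - (A.map C).mulVec h) i ∈ orderIdeal (Fin n) 𝕜 (d + 2) := by
  have taylor := subst_sub_subst_sub_sum_mem_orderIdeal (b := Φ + h) hΦ
    (fun i => add_mem (hΦ i) (orderIdeal_anti d.succ_pos (hh i)))
    (fun i => by simpa only [Pi.add_apply, add_sub_cancel_left] using hh i) (f i)
  simp only [Pi.add_apply, add_sub_cancel_left] at taylor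
  rw [← hf.jacobian_zero]
  exact taylor

/-- The defect `DΦ · F - f ∘ Φ` of `Φ` being solution-preserving from `F` to `f`. -/
def defect (f Φ F : FormalField 𝕜 n) : FormalField 𝕜 n := (jacobian Φ).mulVec F - comp f Φ

theorem defect_X (f F : FormalField 𝕜 n) : defect f X F = F - f := by
  have jacobian_X : jacobian (X : FormalField 𝕜 n) = 1 := by
    rw [← linearField_one, jacobian_linearField, Matrix.map_one _ (map_zero C) (map_one C)]
  have comp_X : comp f X = f := funext fun i => congrFun subst_self (f i)
  rw [defect, jacobian_X, comp_X, Matrix.one_mulVec]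

theorem defect_add_sub_defect_sub (A : Matrix (Fin n) (Fin n) 𝕜) (f Φ F h k : FormalField 𝕜 n) :
    defect f (Φ + h) (F + k) - defect f Φ F - (k + lieBracket (linearField A) h) =
      (jacobian h).mulVec (F - linearField A + k) + (jacobian Φ - 1).mulVec k -
        (comp f (Φ + h) - comp f Φ - (A.map C).mulVec h) := by
  simp only [defect, lieBracket, jacobian_linearField, jacobian_add, Matrix.add_mulVec,
    Matrix.mulVec_add, Matrix.sub_mulVec, Matrix.mulVec_sub, Matrix.one_mulVec]
  abel

theorem defect_add_sub_defect_sub_mem_orderIdeal {d : ℕ} (hf : HasLinearPart f A)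
    (hΦ : HasLinearPart Φ 1) (hF : HasLinearPart F A)
    (hh : ∀ i, h i ∈ orderIdeal (Fin n) 𝕜 (d + 2))
    (hk : ∀ i, k i ∈ orderIdeal (Fin n) 𝕜 (d + 2)) (i : Fin n) :
    (defect f (Φ + h) (F + k) - defect f Φ F - (k + lieBracket (linearField A) h)) i ∈
      orderIdeal (Fin n) 𝕜 (d + 3) := by
  have nonlinear (l : Fin n) : (F - linearField A + k) l ∈ orderIdeal (Fin n) 𝕜 2 :=
    add_mem (hasLinearPart_iff.mp hF l) (orderIdeal_anti (Nat.le_add_left 2 d) (hk l))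
  rw [defect_add_sub_defect_sub]
  refine sub_mem (add_mem ?_ ?_)
    (comp_add_sub_comp_sub_mulVec_mem_orderIdeal hf hΦ.mem_orderIdeal_one hh i)
  · exact mulVec_mem_orderIdeal (jacobian_mem_orderIdeal hh) nonlinear i
  · exact add_comm 1 (d + 2) ▸ mulVec_mem_orderIdeal (jacobian_sub_one_mem_orderIdeal hΦ) hk i

end Defect

section Normalization

variable {n : ℕ} {𝕜 : Type*} [Field 𝕜] {A S N : Matrix (Fin n) (Fin n) 𝕜}
  {f Φ F : FormalField 𝕜 n}

/-- `(Φ, F)` is a normalization of `f` up to terms of order `d`: the field `F` commutes with the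
linear field `S`, and `Φ` is solution-preserving from `F` to `f` modulo terms of order `d`. -/
structure IsApproximateNormalization (A S : Matrix (Fin n) (Fin n) 𝕜) (f : FormalField 𝕜 n)
    (d : ℕ) (Φ F : FormalField 𝕜 n) : Prop where
  linearPart_left : HasLinearPart Φ 1
  linearPart_right : HasLinearPart F A
  bracket : lieBracket (linearField S) F = 0
  defect_mem : ∀ i, defect f Φ F i ∈ orderIdeal (Fin n) 𝕜 d

theorem isApproximateNormalization_linearField (h : Commute S A) (hf : HasLinearPart f A) :
    IsApproximateNormalization A S f 2 X (linearField A) where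
  linearPart_left := linearField_one (𝕜 := 𝕜) (n := n) ▸ hasLinearPart_linearField 1
  linearPart_right := hasLinearPart_linearField A
  bracket := lieBracket_linearField_linearField h
  defect_mem i := by
    rw [defect_X, Pi.sub_apply, ← neg_sub]
    exact neg_mem (hasLinearPart_iff.mp hf i)

theorem IsApproximateNormalization.exists_next [PerfectField 𝕜] (hA : IsJordanChevalley A S N)
    (hf : HasLinearPart f A) {d : ℕ} (hΦF : IsApproximateNormalization A S f (d + 2) Φ F) :
    ∃ Φ' F', IsApproximateNormalization A S f (d + 3) Φ' F' ∧
      (∀ i, Φ' i - Φ i ∈ orderIdeal (Fin n) 𝕜 (d + 2)) ∧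
      ∀ i, F' i - F i ∈ orderIdeal (Fin n) 𝕜 (d + 2) := by
  obtain ⟨k, h, hk, hh, bracket_k, homological⟩ := exists_homological_solution hA (d + 2)
    (e := -homogeneousPart (d + 2) (defect f Φ F))
    fun i => neg_mem (homogeneousComponent_mem_homogeneousSubmodule _ _)
  have order_h (i : Fin n) := mem_orderIdeal_of_mem_homogeneousSubmodule (hh i)
  have order_k (i : Fin n) := mem_orderIdeal_of_mem_homogeneousSubmodule (hk i)
  have sub_Φ (i : Fin n) : (Φ + h) i - Φ i ∈ orderIdeal (Fin n) 𝕜 (d + 2) := by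
    simpa using order_h i
  have sub_F (i : Fin n) : (F + k) i - F i ∈ orderIdeal (Fin n) 𝕜 (d + 2) := by
    simpa using order_k i
  refine ⟨Φ + h, F + k, ⟨?_, ?_, ?_, fun i => ?_⟩, sub_Φ, sub_F⟩
  · exact hΦF.linearPart_left.of_sub_mem fun i => orderIdeal_anti (Nat.le_add_left 2 d) (sub_Φ i)
  · exact hΦF.linearPart_right.of_sub_mem fun i => orderIdeal_anti (Nat.le_add_left 2 d) (sub_F i)
  · rw [lieBracket_add_right, hΦF.bracket, bracket_k, add_zero]
  · have defect_change := defect_add_sub_defect_sub_mem_orderIdeal hf hΦF.linearPart_left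
      hΦF.linearPart_right order_h order_k i
    rw [homological, sub_neg_eq_add] at defect_change
    simpa [homogeneousPart] using add_mem defect_change
      (sub_homogeneousComponent_mem_orderIdeal (hΦF.defect_mem i))

theorem exists_approximateNormalization_seq [PerfectField 𝕜] (hA : IsJordanChevalley A S N)
    (hf : HasLinearPart f A) :
    ∃ Φ F : ℕ → FormalField 𝕜 n, (∀ d, IsApproximateNormalization A S f (d + 2) (Φ d) (F d)) ∧
      (∀ d i, Φ (d + 1) i - Φ d i ∈ orderIdeal (Fin n) 𝕜 (d + 2)) ∧
      ∀ d i, F (d + 1) i - F d i ∈ orderIdeal (Fin n) 𝕜 (d + 2) := by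
  choose nextΦ nextF next sub_Φ sub_F using
    fun (d : ℕ) (P : {P : FormalField 𝕜 n × FormalField 𝕜 n //
      IsApproximateNormalization A S f (d + 2) P.1 P.2}) => P.2.exists_next hA hf
  let u (d : ℕ) : {P : FormalField 𝕜 n × FormalField 𝕜 n //
      IsApproximateNormalization A S f (d + 2) P.1 P.2} :=
    Nat.rec ⟨(X, linearField A), isApproximateNormalization_linearField hA.commute_left hf⟩
      (fun d P => ⟨(nextΦ d P, nextF d P), next d P⟩) d
  exact ⟨fun d => (u d).1.1, fun d => (u d).1.2, fun d => (u d).2, fun d => sub_Φ d (u d),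
    fun d => sub_F d (u d)⟩

theorem IsApproximateNormalization.defect_mem_of_sub_mem {d : ℕ} {Φ' F' : FormalField 𝕜 n}
    (hΦF : IsApproximateNormalization A S f (d + 2) Φ F) (hf : HasLinearPart f A)
    (hΦ : ∀ i, Φ' i - Φ i ∈ orderIdeal (Fin n) 𝕜 (d + 2))
    (hF : ∀ i, F' i - F i ∈ orderIdeal (Fin n) 𝕜 (d + 2)) (i : Fin n) :
    defect f Φ' F' i ∈ orderIdeal (Fin n) 𝕜 (d + 2) := by
  have first_order : (F' - F + lieBracket (linearField A) (Φ' - Φ)) i ∈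
      orderIdeal (Fin n) 𝕜 (d + 2) :=
    add_mem (hF i)
      (lieBracket_mem_orderIdeal (hasLinearPart_linearField A).mem_orderIdeal_one hΦ i)
  have defect_change := orderIdeal_anti (d + 2).le_succ
    (defect_add_sub_defect_sub_mem_orderIdeal hf hΦF.linearPart_left hΦF.linearPart_right
      (h := Φ' - Φ) (k := F' - F) hΦ hF i)
  rw [add_sub_cancel, add_sub_cancel] at defect_change
  simpa using add_mem (add_mem defect_change first_order) (hΦF.defect_mem i)

theorem IsApproximateNormalization.lieBracket_mem_of_sub_mem {d : ℕ} {F' : FormalField 𝕜 n}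
    (hΦF : IsApproximateNormalization A S f (d + 2) Φ F)
    (hF : ∀ i, F' i - F i ∈ orderIdeal (Fin n) 𝕜 (d + 2)) (i : Fin n) :
    lieBracket (linearField S) F' i ∈ orderIdeal (Fin n) 𝕜 (d + 2) := by
  rw [← add_sub_cancel F F', lieBracket_add_right, hΦF.bracket, zero_add]
  exact lieBracket_mem_orderIdeal (hasLinearPart_linearField S).mem_orderIdeal_one hF i

theorem exists_normalization [PerfectField 𝕜] (hA : IsJordanChevalley A S N)
    (hf : HasLinearPart f A) :
    ∃ Φ F : FormalField 𝕜 n, HasLinearPart Φ 1 ∧ HasLinearPart F A ∧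
      IsSolutionPreserving Φ F f ∧ lieBracket (linearField S) F = 0 := by
  obtain ⟨u, v, approx, stable_u, stable_v⟩ := exists_approximateNormalization_seq hA hf
  choose Φ sub_Φ using fun i => exists_limit_of_stabilizing (u · i) (stable_u · i)
  choose F sub_F using fun i => exists_limit_of_stabilizing (v · i) (stable_v · i)
  have eq_zero_of_mem {g : FormalField 𝕜 n}
      (hg : ∀ d i, g i ∈ orderIdeal (Fin n) 𝕜 (d + 2)) : g = 0 :=
    funext fun i => eq_zero_of_forall_mem_orderIdeal fun d =>
      orderIdeal_anti (Nat.le_add_right d 2) (hg d i)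
  refine ⟨Φ, F, (approx 0).linearPart_left.of_sub_mem (sub_Φ · 0),
    (approx 0).linearPart_right.of_sub_mem (sub_F · 0),
    sub_eq_zero.mp (eq_zero_of_mem fun d => ?_), eq_zero_of_mem fun d => ?_⟩
  · exact (approx d).defect_mem_of_sub_mem hf (sub_Φ · d) (sub_F · d)
  · exact (approx d).lieBracket_mem_of_sub_mem (sub_F · d)

end Normalization

section HomogeneousParts

variable {n : ℕ} {𝕜 : Type*} [Field 𝕜] {A S : Matrix (Fin n) (Fin n) 𝕜} {g : FormalField 𝕜 n}

theorem eq_zero_iff_forall_homogeneousPart_eq_zero :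
    g = 0 ↔ ∀ j, homogeneousPart j g = 0 := by
  refine ⟨fun h j => funext fun i => (congrArg _ (congrFun h i)).trans (map_zero _),
    fun h => funext fun i => MvPowerSeries.ext fun m => ?_⟩
  simpa [homogeneousPart, coeff_homogeneousComponent] using
    congrArg (coeff m) (congrFun (h m.degree) i)

theorem HasLinearPart.homogeneousPart_eq (hg : HasLinearPart g A) {j : ℕ} (hj : j < 2) :
    homogeneousPart j g = homogeneousPart j (linearField A) :=
  funext fun i => homogeneousComponent_eq_of_sub_mem_orderIdeal (hasLinearPart_iff.mp hg i) hj

theorem lieBracket_homogeneousPart_eq_zero_of_lt_two (h : Commute S A) (hg : HasLinearPart g A)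
    {j : ℕ} (hj : j < 2) : lieBracket (linearField S) (homogeneousPart j g) = 0 := by
  rw [hg.homogeneousPart_eq hj, ← homogeneousPart_lieBracket_linearField,
    lieBracket_linearField_linearField h]
  exact eq_zero_iff_forall_homogeneousPart_eq_zero.mp rfl j

theorem lieBracket_linearField_eq_zero_iff (h : Commute S A) (hg : HasLinearPart g A) :
    lieBracket (linearField S) g = 0 ↔
      ∀ j, 2 ≤ j → lieBracket (linearField S) (homogeneousPart j g) = 0 := by
  simp only [eq_zero_iff_forall_homogeneousPart_eq_zero (g := lieBracket _ g),
    homogeneousPart_lieBracket_linearField]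
  exact ⟨fun h' j _ => h' j, fun h' j => (lt_or_ge j 2).elim
    (lieBracket_homogeneousPart_eq_zero_of_lt_two h hg) (h' j)⟩

end HomogeneousParts

theorem isJordanChevalley_semisimplePart {𝕜 : Type*} [Field 𝕜] [PerfectField 𝕜] {n : ℕ}
    (B : Matrix (Fin n) (Fin n) 𝕜) : ∃ N, IsJordanChevalley B (semisimplePart B) N :=
  Classical.choose_spec (exists_isJordanChevalley B)

end PoincareDulac

end

theorem theorem4p13_general {𝕜 : Type*} [Field 𝕜] [PerfectField 𝕜] {n : ℕ}
    (A : Matrix (Fin n) (Fin n) 𝕜) (f : PoincareDulac.FormalField 𝕜 n)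
    (hf : PoincareDulac.HasLinearPart f A) :
    (∃ Φ fstar : PoincareDulac.FormalField 𝕜 n,
      PoincareDulac.HasLinearPart Φ 1 ∧
      PoincareDulac.HasLinearPart fstar A ∧
      PoincareDulac.IsSolutionPreserving Φ fstar f ∧
      PoincareDulac.IsNormalForm A fstar) ∧
    (∀ g : PoincareDulac.FormalField 𝕜 n, PoincareDulac.HasLinearPart g A →
      (PoincareDulac.IsNormalForm A g ↔
        ∀ j : ℕ, 2 ≤ j → PoincareDulac.lieBracket
          (PoincareDulac.linearField (PoincareDulac.semisimplePart A))
          (PoincareDulac.homogeneousPart j g) = 0)) := by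
  obtain ⟨N, hA⟩ := PoincareDulac.isJordanChevalley_semisimplePart A
  exact ⟨PoincareDulac.exists_normalization hA hf,
    fun _ => PoincareDulac.lieBracket_linearField_eq_zero_iff hA.commute_left⟩

theorem theorem4p13 {𝕜 : Type*} [RCLike 𝕜] {n : ℕ} (A : Matrix (Fin n) (Fin n) 𝕜)
    (f : PoincareDulac.FormalField 𝕜 n) (hf : PoincareDulac.HasLinearPart f A) :
    (∃ Φ fstar : PoincareDulac.FormalField 𝕜 n,
      PoincareDulac.HasLinearPart Φ 1 ∧
      PoincareDulac.HasLinearPart fstar A ∧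
      PoincareDulac.IsSolutionPreserving Φ fstar f ∧
      PoincareDulac.IsNormalForm A fstar) ∧
    (∀ g : PoincareDulac.FormalField 𝕜 n, PoincareDulac.HasLinearPart g A →
      (PoincareDulac.IsNormalForm A g ↔
        ∀ j : ℕ, 2 ≤ j → PoincareDulac.lieBracket
          (PoincareDulac.linearField (PoincareDulac.semisimplePart A))
          (PoincareDulac.homogeneousPart j g) = 0)) :=
  theorem4p13_general A f hf
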